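/- Let $G$ be a Lie group, $H\subset G$ a closed subgroup, $o=H$ the base point of the homogeneous space $G/H$, and $\mathfrak g=\mathfrak m\oplus\mathfrak h$ a reductive decomposition, i.e. $\mathrm{Ad}(H)\mathfrak m\subset\mathfrak m$, where $\mathfrak g,\mathfrak h$ are the Lie algebras of $G,H$. Write $Z_{\mathfrak m}$ for the $\mathfrak m$-component of $Z\in\mathfrak g$, and identify $\mathfrak m$ with $T_o(G/H)$ through the derivative of the projection $G\to G/H$. Let $\tilde a$ be a $G$-invariant Riemannian metric and $\tilde X$ a $G$-invariant smooth vector field on $G/H$, let $\alpha(x,y)=\sqrt{\tilde a_x(y,y)}$, and put $X=\tilde X(o)$. Let $b_0>0$ and let $\phi$ be a real function that is positive and $C^\infty$ on $(-b_0,b_0)$ with $$\phi(s)-s\phi'(s)+(b^2-s^2)\phi''(s)>0\qquad\text{whenever } |s|\le b<b_0,$$ and suppose that $\alpha(x,\tilde X(x))<b_0$ for every $x\in G/H$. Let $$F(x,y)=\alpha(x,y)\,\phi\!\left(\frac{\tilde a_x(\tilde X(x),y)}{\alpha(x,y)}\right)\quad (y\neq 0),\qquad F(x,0)=0,$$ be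 the corresponding invariant $(\alpha,\beta)$-metric on $G/H$. A nonzero $Y\in\mathfrak g$ is called a geodesic vector of $F$ (respectively of $\tilde a$) if the curve $t\mapsto \exp(tY)\cdot o$ is a constant-speed geodesic of $(G/H,F)$ (respectively of $(G/H,\tilde a)$). Theorem. Let $Y\in\mathfrak g$ with $Y_{\mathfrak m}\neq 0$, and put $$r_{\mathfrak m}=\frac{\tilde a(X,Y_{\mathfrak m})}{\sqrt{\tilde a(Y_{\mathfrak m},Y_{\mathfrak m})}}.$$ Suppose that $\phi''(r_{\mathfrak m})\le 0$ and that $\tilde a(X,[Y,Z]_{\mathfrak m})=0$ for all $Z\in\mathfrak m$. Then $Y$ is a geodesic vector of $F$ if and only if $Y$ is a geodesic vector of $\tilde a$. -/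

import Mathlib

open scoped Manifold ContDiff Bundle

noncomputable section

/-! ### Finsler geodesics and (α, β)-metrics on a manifold -/

section Manifold

variable {E : Type*} [NormedAddCommGroup E] [NormedSpace ℝ E]
  {M : Type*} [TopologicalSpace M] [ChartedSpace E M]

/-- The energy Lagrangian `L = F² / 2` of a function `F` on the tangent bundle, written in the
coordinates `(x, y)` of `TM` induced by the chart at `x₀`. -/
def chartEnergy (F : (x : M) → TangentSpace 𝓘(ℝ, E) x → ℝ) (x₀ : M) (x y : E) : ℝ :=
  F ((extChartAt 𝓘(ℝ, E) x₀).symm x)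
      (mfderiv 𝓘(ℝ, E) 𝓘(ℝ, E) (extChartAt 𝓘(ℝ, E) x₀).symm x y) ^ 2 / 2

/-- `γ` is a (constant speed) geodesic of the Finsler metric `F`: it is smooth and, in the local
coordinates of every preferred chart, it satisfies the geodesic equation
`d/dt (∂L/∂y (c, c')) = ∂L/∂x (c, c')`, where `L = F² / 2` and `c` is the coordinate expression
of `γ`. For `F = √(a(y, y))` these are the geodesics of the Riemannian metric `a`. -/
structure IsGeodesic (F : (x : M) → TangentSpace 𝓘(ℝ, E) x → ℝ) (γ : ℝ → M) : Prop where
  contMDiff : ContMDiff 𝓘(ℝ, ℝ) 𝓘(ℝ, E) ∞ γ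
  euler_lagrange : ∀ (x₀ : M) (t : ℝ), γ t ∈ (extChartAt 𝓘(ℝ, E) x₀).source →
    let c : ℝ → E := fun s => extChartAt 𝓘(ℝ, E) x₀ (γ s)
    HasDerivAt
      (fun s => fderiv ℝ (fun y => chartEnergy F x₀ (c s) y) (deriv c s))
      (fderiv ℝ (fun x => chartEnergy F x₀ x (deriv c t)) (c t)) t

variable [IsManifold 𝓘(ℝ, E) ∞ M]

/-- A smooth Riemannian metric on `M`. -/
abbrev RiemannianMetricOn (E : Type*) [NormedAddCommGroup E] [NormedSpace ℝ E]
    (M : Type*) [TopologicalSpace M] [ChartedSpace E M] [IsManifold 𝓘(ℝ, E) ∞ M] :=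
  Bundle.ContMDiffRiemannianMetric 𝓘(ℝ, E) ∞ E (fun x : M => TangentSpace 𝓘(ℝ, E) x)

/-- `α(x, y) = √(a(y, y))`. -/
def riemannianNorm (a : RiemannianMetricOn E M) (x : M) (y : TangentSpace 𝓘(ℝ, E) x) : ℝ :=
  Real.sqrt (a.inner x y y)

/-- `F(x, y) = α(x, y) φ(a(X(x), y) / α(x, y))`, the value at `y = 0` being `0`. -/
def alphaBetaMetric (a : RiemannianMetricOn E M) (X : (x : M) → TangentSpace 𝓘(ℝ, E) x)
    (φ : ℝ → ℝ) (x : M) (y : TangentSpace 𝓘(ℝ, E) x) : ℝ :=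
  riemannianNorm a x y * φ (a.inner x (X x) y / riemannianNorm a x y)

/-- The conditions on `φ` and on the length of `X` in the definition of an (α, β)-metric. -/
structure IsAlphaBetaData (a : RiemannianMetricOn E M) (X : (x : M) → TangentSpace 𝓘(ℝ, E) x)
    (φ : ℝ → ℝ) (b₀ : ℝ) : Prop where
  contDiffOn : ContDiffOn ℝ ∞ φ (Set.Ioo (-b₀) b₀)
  pos : ∀ s ∈ Set.Ioo (-b₀) b₀, 0 < φ s
  regular : ∀ s b : ℝ, |s| ≤ b → b < b₀ →
    0 < φ s - s * deriv φ s + (b ^ 2 - s ^ 2) * deriv (deriv φ) s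
  contMDiff_field : ContMDiff 𝓘(ℝ, E) (𝓘(ℝ, E).prod 𝓘(ℝ, E)) ∞
    (fun x => (⟨x, X x⟩ : TangentBundle 𝓘(ℝ, E) M))
  norm_lt : ∀ x, riemannianNorm a x (X x) < b₀

end Manifold

/-! ### Homogeneous spaces -/

section Homogeneous

variable {E : Type*} [NormedAddCommGroup E] [NormedSpace ℝ E]
  {G : Type*} [TopologicalSpace G] [ChartedSpace E G] [Group G]
  {E' : Type*} [NormedAddCommGroup E'] [NormedSpace ℝ E']

/-- `γ(t) = exp(tY)`: the one-parameter subgroup of `G` with initial velocity `Y`. -/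
structure IsOneParameterSubgroup (Y : GroupLieAlgebra 𝓘(ℝ, E) G) (γ : ℝ → G) : Prop where
  contMDiff : ContMDiff 𝓘(ℝ, ℝ) 𝓘(ℝ, E) ∞ γ
  map_add : ∀ s t, γ (s + t) = γ s * γ t
  velocity : mfderiv 𝓘(ℝ, ℝ) 𝓘(ℝ, E) γ 0 (1 : ℝ) = Y

/-- `Ad(g) Z`, the derivative at `1` of `x ↦ g x g⁻¹` applied to `Z`. -/
def adjointAction (g : G) (Z : GroupLieAlgebra 𝓘(ℝ, E) G) : GroupLieAlgebra 𝓘(ℝ, E) G :=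
  mfderiv 𝓘(ℝ, E) 𝓘(ℝ, E) (fun x : G => g * x * g⁻¹) (1 : G) Z

variable (H : Subgroup G)

/-- The base point `o = H` of `G/H`. -/
def basePoint : G ⧸ H := ((1 : G) : G ⧸ H)

variable [ChartedSpace E' (G ⧸ H)]

/-- The derivative at `1` of the projection `π : G → G/H`, from `𝔤` to `T_o(G/H)`. -/
def dProj : GroupLieAlgebra 𝓘(ℝ, E) G →L[ℝ] TangentSpace 𝓘(ℝ, E') (basePoint H) :=
  mfderiv 𝓘(ℝ, E) 𝓘(ℝ, E') (fun g : G => (g : G ⧸ H)) (1 : G)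

/-- The manifold structure on `G/H` is the quotient one: the unique smooth structure for which
the projection `G → G/H` is a smooth submersion. -/
structure IsQuotientStructure : Prop where
  contMDiff : ContMDiff 𝓘(ℝ, E) 𝓘(ℝ, E') ∞ (fun g : G => (g : G ⧸ H))
  submersion : ∀ g : G,
    Function.Surjective (mfderiv 𝓘(ℝ, E) 𝓘(ℝ, E') (fun g : G => (g : G ⧸ H)) g)

/-- The Lie algebra `𝔥 = T_1 H` of `H`, as the kernel of `dπ : 𝔤 → T_o(G/H)`. -/
def isotropyAlgebra : Submodule ℝ (GroupLieAlgebra 𝓘(ℝ, E) G) :=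
  LinearMap.ker (dProj (E := E) (E' := E') H).toLinearMap

/-- `𝔤 = 𝔪 ⊕ 𝔥` is a reductive decomposition: `Ad(h) 𝔪 ⊆ 𝔪` for `h ∈ H`. -/
structure IsReductiveDecomposition (m : Submodule ℝ (GroupLieAlgebra 𝓘(ℝ, E) G)) : Prop where
  isCompl : IsCompl m (isotropyAlgebra (E := E) (E' := E') H)
  adjoint_mem : ∀ h ∈ H, ∀ Z ∈ m, adjointAction h Z ∈ m

variable {H} in
/-- The `𝔪`-component `Z_𝔪` of `Z ∈ 𝔤 = 𝔪 ⊕ 𝔥`. -/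
def IsReductiveDecomposition.proj {m : Submodule ℝ (GroupLieAlgebra 𝓘(ℝ, E) G)}
    (hm : IsReductiveDecomposition (E' := E') H m) (Z : GroupLieAlgebra 𝓘(ℝ, E) G) :
    GroupLieAlgebra 𝓘(ℝ, E) G :=
  m.projection (isotropyAlgebra (E := E) (E' := E') H) hm.isCompl Z

/-- `Y ∈ 𝔤` is a geodesic vector of the metric `F` on `G/H`: it is nonzero and the curve
`t ↦ exp(tY)(o)` is a geodesic. -/
def IsGeodesicVector (F : (x : G ⧸ H) → TangentSpace 𝓘(ℝ, E') x → ℝ)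
    (Y : GroupLieAlgebra 𝓘(ℝ, E) G) : Prop :=
  Y ≠ 0 ∧ ∃ γ : ℝ → G, IsOneParameterSubgroup Y γ ∧ IsGeodesic F (fun t => γ t • basePoint H)

variable {H} in
/-- The Riemannian metric `a` on `G/H` is invariant under the action of `G`. -/
def IsInvariantMetric [IsManifold 𝓘(ℝ, E') ∞ (G ⧸ H)] (a : RiemannianMetricOn E' (G ⧸ H)) : Prop :=
  ∀ (g : G) (x : G ⧸ H) (u v : TangentSpace 𝓘(ℝ, E') x),
    a.inner (g • x) (mfderiv 𝓘(ℝ, E') 𝓘(ℝ, E') (fun z : G ⧸ H => g • z) x u)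
      (mfderiv 𝓘(ℝ, E') 𝓘(ℝ, E') (fun z : G ⧸ H => g • z) x v) = a.inner x u v

variable {H} in
/-- The vector field `X` on `G/H` is invariant under the action of `G`. -/
def IsInvariantField (X : (x : G ⧸ H) → TangentSpace 𝓘(ℝ, E') x) : Prop :=
  ∀ (g : G) (x : G ⧸ H),
    mfderiv 𝓘(ℝ, E') 𝓘(ℝ, E') (fun z : G ⧸ H => g • z) x (X x) = X (g • x)

variable {H} in
/-- The inner product `a(u, v)` of `u, v ∈ 𝔪`, under the identification `𝔪 ≅ T_o(G/H)`
given by `dπ`, for a vector `u` already taken in `T_o(G/H)`. -/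
def innerAtBase [IsManifold 𝓘(ℝ, E') ∞ (G ⧸ H)] (a : RiemannianMetricOn E' (G ⧸ H))
    (u : TangentSpace 𝓘(ℝ, E') (basePoint H)) (v : GroupLieAlgebra 𝓘(ℝ, E) G) : ℝ :=
  a.inner (basePoint H) u (dProj H v)

end Homogeneous

end

/-! The energy of `F` is `Φ(L, β)`, where `L = α²/2`, `β = a(X, ·)` and `Φ(l, b) = l φ(b/√(2l))²`.
Along `exp(tY)·o` the velocity at `gH` is the translate by `g` of `dπ(Y)`, so by invariance `L` and
`β` are constant on it, and so are the partial derivatives of `Φ`. They therefore pass through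
`d/dt`, and the Euler-Lagrange expressions satisfy `EL(F) = Φ_l · EL(α) + Φ_b · EL(β)`
(`hasDerivAt_alphaBetaMetric_iff`).

The term `EL(β)` is, up to sign, `dβ(c', ·)`. The pullback of `β` to `G` is left-invariant, so
Cartan's formula gives `dβ(Y, W) = -a(X, [Y, W])`. This vanishes for `W ∈ 𝔪`, and such `W` reach
every tangent vector of `G/H` (`IsInvariantMetric.fderiv_chartForm_symm`).

Finally `Φ_l = φ(r)(φ(r) - r φ'(r))` is nonzero: Cauchy-Schwarz gives `|r| < b₀`, and the regularity
condition at `b = |r|` gives positivity. Hence `EL(F) = 0` exactly when `EL(α) = 0`. -/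

noncomputable section

/-! ### The energy of an (α, β)-metric and its Euler-Lagrange equation in a chart. -/

section Manifold

open Filter Topology

/-- The function `Φ(l, b) = l φ(b / √(2l))²` expressing the energy of an `(α, β)`-metric through
the Riemannian energy `l = α² / 2` and the one-form `b = β`. -/
def alphaBetaEnergy (φ : ℝ → ℝ) (p : ℝ × ℝ) : ℝ :=
  p.1 * φ (p.2 / Real.sqrt (2 * p.1)) ^ 2

/-- The quotient `b/√(2l)` has `l`-derivative `-r/(2l)`, which produces the term `-r φ φ'`. Both
coefficients depend on `l` and `r` alone, hence are constant along a curve on which `l` and `b` are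
constant. -/
lemma hasFDerivAt_alphaBetaEnergy {φ : ℝ → ℝ} {l b r : ℝ} (hl : 0 < l)
    (hr : r = b / Real.sqrt (2 * l)) (hφ : DifferentiableAt ℝ φ r) :
    HasFDerivAt (alphaBetaEnergy φ)
      ((φ r * (φ r - r * deriv φ r)) • ContinuousLinearMap.fst ℝ ℝ ℝ +
        (Real.sqrt (2 * l) * φ r * deriv φ r) • ContinuousLinearMap.snd ℝ ℝ ℝ) (l, b) := by
  have hs : 0 < Real.sqrt (2 * l) := Real.sqrt_pos.2 (by positivity)
  have hsq : Real.sqrt (2 * l) ^ 2 = 2 * l := Real.sq_sqrt (by positivity)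
  have h1 : HasFDerivAt (fun p : ℝ × ℝ => p.1) (ContinuousLinearMap.fst ℝ ℝ ℝ) (l, b) :=
    hasFDerivAt_fst
  have h2 : HasFDerivAt (fun p : ℝ × ℝ => p.2) (ContinuousLinearMap.snd ℝ ℝ ℝ) (l, b) :=
    hasFDerivAt_snd
  have h3 := (h1.const_mul 2).sqrt (by simpa using hl.ne')
  have h4 := h2.mul ((hasDerivAt_inv hs.ne').comp_hasFDerivAt (l, b) h3)
  have h5 : HasDerivAt φ (deriv φ r) (b * (Real.sqrt (2 * l))⁻¹) := by
    rw [← div_eq_mul_inv, ← hr]; exact hφ.hasDerivAt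
  have h6 := h1.mul ((HasDerivAt.comp_hasFDerivAt (l, b) h5 h4).pow 2)
  have hb : b = r * Real.sqrt (2 * l) := by rw [hr]; field_simp
  have hr' : b * (Real.sqrt (2 * l))⁻¹ = r := by rw [hr, div_eq_mul_inv]
  refine (h6.congr_fderiv ?_).congr_of_eventuallyEq (Eventually.of_forall fun p => ?_)
  · ext
    · simp [hr', -Real.sqrt_mul, -Real.sqrt_mul', -Nat.ofNat_nonneg, -Nat.ofNat_pos]
      rw [hb]
      generalize Real.sqrt (2 * l) = q at *
      obtain rfl : l = q ^ 2 / 2 := by linarith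
      field_simp
      ring
    · simp [hr', -Real.sqrt_mul, -Real.sqrt_mul', -Nat.ofNat_nonneg, -Nat.ofNat_pos]
      generalize Real.sqrt (2 * l) = q at *
      obtain rfl : l = q ^ 2 / 2 := by linarith
      field_simp
  · simp [alphaBetaEnergy, div_eq_mul_inv]

variable {E : Type*} [NormedAddCommGroup E] [NormedSpace ℝ E]

/-- Chain rule. -/
lemma fderiv_alphaBetaEnergy_comp {φ : ℝ → ℝ} {r : ℝ} {f g : E → ℝ} {v : E} (hl : 0 < f v)
    (hr : r = g v / Real.sqrt (2 * f v)) (hφ : DifferentiableAt ℝ φ r)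
    (hf : DifferentiableAt ℝ f v) (hg : DifferentiableAt ℝ g v) :
    fderiv ℝ (fun z => alphaBetaEnergy φ (f z, g z)) v =
      (φ r * (φ r - r * deriv φ r)) • fderiv ℝ f v +
        (Real.sqrt (2 * f v) * φ r * deriv φ r) • fderiv ℝ g v := by
  have h := (hasFDerivAt_alphaBetaEnergy hl hr hφ).comp v (hf.hasFDerivAt.prodMk hg.hasFDerivAt)
  exact h.fderiv.trans (by ext; simp)

variable {M : Type*} [TopologicalSpace M] [ChartedSpace E M] [IsManifold 𝓘(ℝ, E) ∞ M]

/-- The one-form `β = a(X, ·)` in the chart at `x₀`. -/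
def chartForm (a : RiemannianMetricOn E M) (X : (x : M) → TangentSpace 𝓘(ℝ, E) x) (x₀ : M)
    (z : E) : E →L[ℝ] ℝ :=
  (a.inner ((extChartAt 𝓘(ℝ, E) x₀).symm z) (X ((extChartAt 𝓘(ℝ, E) x₀).symm z))).comp
    (mfderiv 𝓘(ℝ, E) 𝓘(ℝ, E) (extChartAt 𝓘(ℝ, E) x₀).symm z)

lemma metric_self_nonneg (a : RiemannianMetricOn E M) (x : M) (v : TangentSpace 𝓘(ℝ, E) x) :
    0 ≤ a.inner x v v := by
  rcases eq_or_ne v 0 with rfl | hv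
  · simp
  · exact (a.pos x v hv).le

lemma chartEnergy_riemannianNorm (a : RiemannianMetricOn E M) (x₀ : M) (z y : E) :
    chartEnergy (riemannianNorm a) x₀ z y =
      a.inner ((extChartAt 𝓘(ℝ, E) x₀).symm z)
        (mfderiv 𝓘(ℝ, E) 𝓘(ℝ, E) (extChartAt 𝓘(ℝ, E) x₀).symm z y)
        (mfderiv 𝓘(ℝ, E) 𝓘(ℝ, E) (extChartAt 𝓘(ℝ, E) x₀).symm z y) / 2 := by
  rw [chartEnergy, riemannianNorm, Real.sq_sqrt (metric_self_nonneg a _ _)]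

/-- No case distinction at `y = 0` is needed: there the prefactor `α` vanishes, so both sides are
zero whatever value the quotient takes. -/
lemma chartEnergy_alphaBetaMetric (a : RiemannianMetricOn E M)
    (X : (x : M) → TangentSpace 𝓘(ℝ, E) x) (φ : ℝ → ℝ) (x₀ : M) (z y : E) :
    chartEnergy (alphaBetaMetric a X φ) x₀ z y =
      alphaBetaEnergy φ (chartEnergy (riemannianNorm a) x₀ z y, chartForm a X x₀ z y) := by
  rw [chartEnergy_riemannianNorm, chartEnergy, alphaBetaMetric, alphaBetaEnergy, riemannianNorm,
    mul_pow, Real.sq_sqrt (metric_self_nonneg a _ _)]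
  simp only [chartForm, mul_div_cancel₀ _ (two_ne_zero' ℝ)]
  exact mul_div_right_comm _ _ _

lemma differentiableAt_chartEnergy_fiber (a : RiemannianMetricOn E M) (x₀ : M) (z y : E) :
    DifferentiableAt ℝ (fun y => chartEnergy (riemannianNorm a) x₀ z y) y := by
  have h (A : E →L[ℝ] E →L[ℝ] ℝ) (D : E →L[ℝ] E) :
      DifferentiableAt ℝ (fun y => A (D y) (D y) / 2) y := by fun_prop
  exact (h (a.inner ((extChartAt 𝓘(ℝ, E) x₀).symm z))
    (mfderiv 𝓘(ℝ, E) 𝓘(ℝ, E) (extChartAt 𝓘(ℝ, E) x₀).symm z)).congr_of_eventuallyEq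
    (Eventually.of_forall fun y => chartEnergy_riemannianNorm a x₀ z y)

/-- This is the tangent map of the inverse chart composed with the constant section `z ↦ (z, u)`. -/
lemma contMDiffOn_mfderiv_extChartAt_symm (x₀ : M) (u : E) :
    ContMDiffOn 𝓘(ℝ, E) (𝓘(ℝ, E).prod 𝓘(ℝ, E)) 1
      (fun z : E => (⟨(extChartAt 𝓘(ℝ, E) x₀).symm z,
        mfderiv 𝓘(ℝ, E) 𝓘(ℝ, E) (extChartAt 𝓘(ℝ, E) x₀).symm z u⟩ : TangentBundle 𝓘(ℝ, E) M))
      (extChartAt 𝓘(ℝ, E) x₀).target := by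
  have ho : IsOpen (extChartAt 𝓘(ℝ, E) x₀).target := isOpen_extChartAt_target x₀
  have h := (contMDiffOn_extChartAt_symm (I := 𝓘(ℝ, E)) (n := ∞) x₀).contMDiffOn_tangentMapWithin
    (m := 1) (by norm_cast) ho.uniqueMDiffOn
  have hs : ContMDiff 𝓘(ℝ, E) (𝓘(ℝ, E).prod 𝓘(ℝ, E)) 1
      (fun z : E => (⟨z, u⟩ : TangentBundle 𝓘(ℝ, E) E)) := by
    intro z
    exact contMDiffAt_vectorSpace_iff_contDiffAt.2 contDiffAt_const
  refine (h.comp hs.contMDiffOn (fun z hz => hz)).congr fun z hz => ?_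
  simp only [tangentMapWithin, Function.comp_apply, mfderivWithin_of_isOpen ho hz]

/-- The metric is smooth only as a section of a bundle of bilinear forms. Evaluating it on two
sections gives a map into the trivial line bundle, whose fibre component is the function in
question. -/
lemma differentiableAt_metric_of_contMDiffOn (a : RiemannianMetricOn E M) {s : Set E}
    (hs : IsOpen s) {ψ : E → M} {V W : (z : E) → TangentSpace 𝓘(ℝ, E) (ψ z)}
    (hψ : ContMDiffOn 𝓘(ℝ, E) 𝓘(ℝ, E) 1 ψ s)
    (hV : ContMDiffOn 𝓘(ℝ, E) (𝓘(ℝ, E).prod 𝓘(ℝ, E)) 1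
      (fun z => (⟨ψ z, V z⟩ : TangentBundle 𝓘(ℝ, E) M)) s)
    (hW : ContMDiffOn 𝓘(ℝ, E) (𝓘(ℝ, E).prod 𝓘(ℝ, E)) 1
      (fun z => (⟨ψ z, W z⟩ : TangentBundle 𝓘(ℝ, E) M)) s) {z : E} (hz : z ∈ s) :
    DifferentiableAt ℝ (fun z => a.inner (ψ z) (V z) (W z)) z := by
  have ha : ContMDiffOn 𝓘(ℝ, E) (𝓘(ℝ, E).prod 𝓘(ℝ, E →L[ℝ] E →L[ℝ] ℝ)) 1
      (fun z => Bundle.TotalSpace.mk' (E →L[ℝ] E →L[ℝ] ℝ)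
        (E := fun x : M => TangentSpace 𝓘(ℝ, E) x →L[ℝ] TangentSpace 𝓘(ℝ, E) x →L[ℝ] ℝ)
        (ψ z) (a.inner (ψ z))) s :=
    (a.contMDiff.of_le (by norm_cast)).comp_contMDiffOn hψ
  have h : ContMDiffOn 𝓘(ℝ, E) (𝓘(ℝ, E).prod 𝓘(ℝ, ℝ)) 1
      (fun z => Bundle.TotalSpace.mk' ℝ (E := Bundle.Trivial M ℝ) (ψ z)
        (a.inner (ψ z) (V z) (W z))) s :=
    ContMDiffOn.clm_bundle_apply₂ (F₁ := E) (F₂ := E) ha hV hW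
  have h2 := (h.contMDiffAt (hs.mem_nhds hz))
  simp only [Bundle.contMDiffAt_totalSpace] at h2
  exact (contMDiffAt_iff_contDiffAt.1 h2.2).differentiableAt one_ne_zero

lemma differentiableAt_chartEnergy_base (a : RiemannianMetricOn E M) (x₀ : M) {z : E} (y : E)
    (hz : z ∈ (extChartAt 𝓘(ℝ, E) x₀).target) :
    DifferentiableAt ℝ (fun z => chartEnergy (riemannianNorm a) x₀ z y) z := by
  simp_rw [chartEnergy_riemannianNorm, div_eq_mul_inv]
  have h := contMDiffOn_mfderiv_extChartAt_symm x₀ y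
  exact (differentiableAt_metric_of_contMDiffOn a (isOpen_extChartAt_target x₀)
    (contMDiffOn_extChartAt_symm x₀) h h hz).mul_const (2⁻¹ : ℝ)

lemma differentiableAt_chartForm_apply (a : RiemannianMetricOn E M)
    {X : (x : M) → TangentSpace 𝓘(ℝ, E) x}
    (hX : ContMDiff 𝓘(ℝ, E) (𝓘(ℝ, E).prod 𝓘(ℝ, E)) ∞
      (fun x => (⟨x, X x⟩ : TangentBundle 𝓘(ℝ, E) M))) (x₀ : M) {z : E} (y : E)
    (hz : z ∈ (extChartAt 𝓘(ℝ, E) x₀).target) :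
    DifferentiableAt ℝ (fun z => chartForm a X x₀ z y) z :=
  differentiableAt_metric_of_contMDiffOn a (isOpen_extChartAt_target x₀)
    (contMDiffOn_extChartAt_symm x₀)
    ((hX.of_le (by norm_cast)).comp_contMDiffOn (contMDiffOn_extChartAt_symm x₀))
    (contMDiffOn_mfderiv_extChartAt_symm x₀ y) hz

/-- In finite dimension the dual of `E` is `ℝ^d` through evaluation on a basis, so differentiability
can be tested on vectors. -/
lemma differentiableAt_clm_of_apply [FiniteDimensional ℝ E] {B : E → E →L[ℝ] ℝ} {z : E}
    (h : ∀ y, DifferentiableAt ℝ (fun z => B z y) z) : DifferentiableAt ℝ B z := by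
  let d := Module.finrank ℝ E
  have hd : d = Module.finrank ℝ (Fin d → ℝ) := (Module.finrank_fin_fun ℝ).symm
  let e₁ := ContinuousLinearEquiv.ofFinrankEq hd
  let e₂ := (e₁.arrowCongr (1 : ℝ ≃L[ℝ] ℝ)).trans (ContinuousLinearEquiv.piRing (Fin d))
  rw [← e₂.comp_differentiableAt_iff, differentiableAt_pi]
  exact fun i => h _

/-- Along a curve on which the length `√N` of the velocity and the value `b` of `β` on it are
constant, and for which `β` satisfies the Euler-Lagrange equation, the Euler-Lagrange equations
of the `(α, β)`-metric and of `α` agree. -/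
lemma hasDerivAt_alphaBetaMetric_iff (a : RiemannianMetricOn E M)
    {X : (x : M) → TangentSpace 𝓘(ℝ, E) x}
    (hX : ContMDiff 𝓘(ℝ, E) (𝓘(ℝ, E).prod 𝓘(ℝ, E)) ∞
      (fun x => (⟨x, X x⟩ : TangentBundle 𝓘(ℝ, E) M)))
    {φ : ℝ → ℝ} (x₀ : M) {c c' : ℝ → E} {t l b r : ℝ} (hl : 0 < l)
    (hr : r = b / Real.sqrt (2 * l)) (hφ : DifferentiableAt ℝ φ r)
    (hφ0 : φ r * (φ r - r * deriv φ r) ≠ 0)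
    (hc : c t ∈ (extChartAt 𝓘(ℝ, E) x₀).target)
    (hcl : ∀ᶠ s in 𝓝 t, chartEnergy (riemannianNorm a) x₀ (c s) (c' s) = l)
    (hcb : ∀ᶠ s in 𝓝 t, chartForm a X x₀ (c s) (c' s) = b)
    (hβ : HasDerivAt (fun s => chartForm a X x₀ (c s))
      (fderiv ℝ (fun z => chartForm a X x₀ z (c' t)) (c t)) t) :
    HasDerivAt
        (fun s => fderiv ℝ (fun y => chartEnergy (alphaBetaMetric a X φ) x₀ (c s) y) (c' s))
        (fderiv ℝ (fun x => chartEnergy (alphaBetaMetric a X φ) x₀ x (c' t)) (c t)) t ↔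
      HasDerivAt
        (fun s => fderiv ℝ (fun y => chartEnergy (riemannianNorm a) x₀ (c s) y) (c' s))
        (fderiv ℝ (fun x => chartEnergy (riemannianNorm a) x₀ x (c' t)) (c t)) t := by
  simp_rw [chartEnergy_alphaBetaMetric]
  have hlt := hcl.self_of_nhds
  have hbt := hcb.self_of_nhds
  rw [fderiv_alphaBetaEnergy_comp (r := r) (hlt ▸ hl) (by rw [hlt, hbt, hr]) hφ
    (differentiableAt_chartEnergy_base a x₀ _ hc)
    (differentiableAt_chartForm_apply a hX x₀ _ hc), hlt]
  -- Equality is needed on a neighbourhood of `t`, since this momentum is about to be differentiated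
  -- in `s`. The momentum of `β` is `β` itself, being linear in `y`.
  have hev : (fun s => fderiv ℝ (fun y => alphaBetaEnergy φ
      (chartEnergy (riemannianNorm a) x₀ (c s) y, chartForm a X x₀ (c s) y)) (c' s)) =ᶠ[𝓝 t]
      fun s => (φ r * (φ r - r * deriv φ r)) •
          fderiv ℝ (fun y => chartEnergy (riemannianNorm a) x₀ (c s) y) (c' s) +
        (Real.sqrt (2 * l) * φ r * deriv φ r) • chartForm a X x₀ (c s) := by
    filter_upwards [hcl, hcb] with s hs hs'
    rw [fderiv_alphaBetaEnergy_comp (r := r) (hs ▸ hl) (by rw [hs, hs', hr]) hφ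
      (differentiableAt_chartEnergy_fiber a x₀ _ _)
      (chartForm a X x₀ (c s)).differentiableAt, hs, ContinuousLinearMap.fderiv]
  rw [hev.hasDerivAt_iff]
  have hβ' := hβ.const_smul (Real.sqrt (2 * l) * φ r * deriv φ r)
  refine ⟨fun h => ?_, fun h => (h.const_smul (φ r * (φ r - r * deriv φ r))).add hβ'⟩
  -- Removing the contribution of `β` leaves a nonzero constant times the equation for `α`.
  have h1 := (h.sub hβ').const_smul (φ r * (φ r - r * deriv φ r))⁻¹
  simpa [Pi.smul_def, Pi.sub_def, smul_smul, inv_mul_cancel₀ hφ0, -mul_inv_rev] using h1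

end Manifold

/-! ### Cartan's formula and derivatives read in charts. -/

section ChartCalculus

open Filter Topology

/-- Cartan's formula `dβ(u, v) = u(β(v)) - v(β(u)) - β([u, v])` for a one-form `B` pulled back by
`U`, for vector fields on which the pullback is constant. -/
lemma fderiv_apply_sub_eq_of_const {E E' : Type*} [NormedAddCommGroup E] [NormedSpace ℝ E]
    [NormedAddCommGroup E'] [NormedSpace ℝ E'] {B : E' → E' →L[ℝ] ℝ} {U : E → E'}
    {v w : E → E} {e : E} {k l : ℝ} (hB : DifferentiableAt ℝ B (U e)) (hU : ContDiffAt ℝ 2 U e)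
    (hv : DifferentiableAt ℝ v e) (hw : DifferentiableAt ℝ w e)
    (hcv : ∀ᶠ x in 𝓝 e, B (U x) (fderiv ℝ U x (v x)) = k)
    (hcw : ∀ᶠ x in 𝓝 e, B (U x) (fderiv ℝ U x (w x)) = l) :
    fderiv ℝ B (U e) (fderiv ℝ U e (v e)) (fderiv ℝ U e (w e)) -
        fderiv ℝ B (U e) (fderiv ℝ U e (w e)) (fderiv ℝ U e (v e)) =
      -B (U e) (fderiv ℝ U e (VectorField.lieBracket ℝ v w e)) := by
  have hU1 : HasFDerivAt U (fderiv ℝ U e) e := (hU.differentiableAt two_ne_zero).hasFDerivAt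
  have hU2 : HasFDerivAt (fderiv ℝ U) (fderiv ℝ (fderiv ℝ U) e) e :=
    ((hU.fderiv_right (m := 1) (by norm_num)).differentiableAt one_ne_zero).hasFDerivAt
  have hsymm : fderiv ℝ (fderiv ℝ U) e (v e) (w e) = fderiv ℝ (fderiv ℝ U) e (w e) (v e) :=
    (hU.isSymmSndFDerivAt (by simp)).eq _ _
  -- Differentiating the constant pairing in a direction `d` gives zero. Subtracting the instances
  -- `(v, w)` and `(w, v)` cancels the second derivatives of `U` by symmetry and leaves the bracket.
  have key : ∀ {u : E → E} {k : ℝ}, DifferentiableAt ℝ u e →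
      (∀ᶠ x in 𝓝 e, B (U x) (fderiv ℝ U x (u x)) = k) → ∀ d,
      B (U e) (fderiv ℝ U e (fderiv ℝ u e d) + fderiv ℝ (fderiv ℝ U) e d (u e)) +
        fderiv ℝ B (U e) (fderiv ℝ U e d) (fderiv ℝ U e (u e)) = 0 := by
    intro u k hu hc d
    have h1 := (hB.hasFDerivAt.comp e hU1).clm_apply (hU2.clm_apply hu.hasFDerivAt)
    have h2 : HasFDerivAt (fun x => B (U x) (fderiv ℝ U x (u x))) (0 : E →L[ℝ] ℝ) e :=
      (hasFDerivAt_const k e).congr_of_eventuallyEq hc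
    simpa using congr($(h1.unique h2) d)
  have h1 := key hv hcv (w e)
  have h2 := key hw hcw (v e)
  simp only [VectorField.lieBracket, map_sub, map_add, hsymm] at *
  linarith

variable {E : Type*} [NormedAddCommGroup E] [NormedSpace ℝ E]
  {M : Type*} [TopologicalSpace M] [ChartedSpace E M] [IsManifold 𝓘(ℝ, E) ∞ M]

lemma mfderiv_extChartAt_symm_mfderiv_extChartAt {x₀ x : M}
    (hx : x ∈ (extChartAt 𝓘(ℝ, E) x₀).source) (v : TangentSpace 𝓘(ℝ, E) x) :
    (mfderiv 𝓘(ℝ, E) 𝓘(ℝ, E) (extChartAt 𝓘(ℝ, E) x₀).symm (extChartAt 𝓘(ℝ, E) x₀ x) : E →L[ℝ] E)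
      ((mfderiv 𝓘(ℝ, E) 𝓘(ℝ, E) (extChartAt 𝓘(ℝ, E) x₀) x : E →L[ℝ] E) v) = (v : E) := by
  have : IsManifold 𝓘(ℝ, E) 1 M := IsManifold.of_le (n := ∞) (by norm_cast)
  have h := mfderivWithin_extChartAt_symm_comp_mfderiv_extChartAt' (I := 𝓘(ℝ, E)) hx
  rw [ModelWithCorners.range_eq_univ, mfderivWithin_univ] at h
  exact congr($h v)

lemma mfderiv_extChartAt_mfderiv_extChartAt_symm {x₀ x : M}
    (hx : x ∈ (extChartAt 𝓘(ℝ, E) x₀).source) (v : E) :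
    (mfderiv 𝓘(ℝ, E) 𝓘(ℝ, E) (extChartAt 𝓘(ℝ, E) x₀) x : E →L[ℝ] E)
      ((mfderiv 𝓘(ℝ, E) 𝓘(ℝ, E) (extChartAt 𝓘(ℝ, E) x₀).symm (extChartAt 𝓘(ℝ, E) x₀ x) :
        E →L[ℝ] E) v) = v := by
  have : IsManifold 𝓘(ℝ, E) 1 M := IsManifold.of_le (n := ∞) (by norm_cast)
  have h := mfderiv_extChartAt_comp_mfderivWithin_extChartAt_symm' (I := 𝓘(ℝ, E)) hx
  rw [ModelWithCorners.range_eq_univ, mfderivWithin_univ] at h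
  exact congr($h v)

lemma chartForm_extChartAt_apply (a : RiemannianMetricOn E M)
    (X : (x : M) → TangentSpace 𝓘(ℝ, E) x) {x₀ x : M} (hx : x ∈ (extChartAt 𝓘(ℝ, E) x₀).source)
    (y : E) : chartForm a X x₀ (extChartAt 𝓘(ℝ, E) x₀ x) y =
      (a.inner x (X x) : E →L[ℝ] ℝ) ((mfderiv 𝓘(ℝ, E) 𝓘(ℝ, E) (extChartAt 𝓘(ℝ, E) x₀).symm
        (extChartAt 𝓘(ℝ, E) x₀ x) : E →L[ℝ] E) y) := by
  -- All tangent spaces are definitionally `E`, so with `w : E` fixed the base point can be replaced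
  -- by substitution, where rewriting would meet dependent types.
  have h : ∀ q : M, q = x → ∀ w : E, (a.inner q (X q) : E →L[ℝ] ℝ) w = a.inner x (X x) w := by
    rintro _ rfl w; rfl
  exact h _ ((extChartAt 𝓘(ℝ, E) x₀).left_inv hx) _

lemma chartEnergy_riemannianNorm_extChartAt (a : RiemannianMetricOn E M) {x₀ x : M}
    (hx : x ∈ (extChartAt 𝓘(ℝ, E) x₀).source) {y : E} {v : TangentSpace 𝓘(ℝ, E) x}
    (hy : (mfderiv 𝓘(ℝ, E) 𝓘(ℝ, E) (extChartAt 𝓘(ℝ, E) x₀).symm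
        (extChartAt 𝓘(ℝ, E) x₀ x) : E →L[ℝ] E) y = v) :
    chartEnergy (riemannianNorm a) x₀ (extChartAt 𝓘(ℝ, E) x₀ x) y = a.inner x v v / 2 := by
  have h : ∀ q : M, q = x → ∀ w : E, (a.inner q : E →L[ℝ] E →L[ℝ] ℝ) w w / 2 =
      (a.inner x : E →L[ℝ] E →L[ℝ] ℝ) w w / 2 := by
    rintro _ rfl w; rfl
  rw [chartEnergy_riemannianNorm, ← hy]
  exact h _ ((extChartAt 𝓘(ℝ, E) x₀).left_inv hx) _

/-- The chart at `x₀` recovers the derivative of a map into the manifold from the derivative of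
its coordinate expression. -/
lemma mfderiv_extChartAt_symm_fderiv {F : Type*} [NormedAddCommGroup F] [NormedSpace ℝ F]
    {f : F → M} {x₀ : M} {z : F} (hf : MDifferentiableAt 𝓘(ℝ, F) 𝓘(ℝ, E) f z)
    (hz : f z ∈ (extChartAt 𝓘(ℝ, E) x₀).source) (v : F) :
    (mfderiv 𝓘(ℝ, E) 𝓘(ℝ, E) (extChartAt 𝓘(ℝ, E) x₀).symm (extChartAt 𝓘(ℝ, E) x₀ (f z)) :
        E →L[ℝ] E) (fderiv ℝ (fun z => extChartAt 𝓘(ℝ, E) x₀ (f z)) z v) =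
      (mfderiv 𝓘(ℝ, F) 𝓘(ℝ, E) f z : F →L[ℝ] E) v := by
  have : IsManifold 𝓘(ℝ, E) 1 M := IsManifold.of_le (n := ∞) (by norm_cast)
  have hext : MDifferentiableAt 𝓘(ℝ, E) 𝓘(ℝ, E) (extChartAt 𝓘(ℝ, E) x₀) (f z) :=
    mdifferentiableAt_extChartAt (by simpa using hz)
  have h := mfderiv_comp z hext hf
  rw [mfderiv_eq_fderiv] at h
  have h2 := mfderiv_extChartAt_symm_mfderiv_extChartAt hz (mfderiv 𝓘(ℝ, F) 𝓘(ℝ, E) f z v)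
  rw [← h2]
  exact congrArg _ (congr($h v))

end ChartCalculus

/-! ### Invariant metrics, fields and one-forms pulled back to the group. -/

section Homogeneous

open Filter Topology

lemma mk_eq_smul_basePoint {G : Type*} [Group G] {H : Subgroup G} (g : G) : (g : G ⧸ H) = g • basePoint H := by
  simp [basePoint]

variable {E : Type*} [NormedAddCommGroup E] [NormedSpace ℝ E]
  {G : Type*} [TopologicalSpace G] [ChartedSpace E G] [Group G] [LieGroup 𝓘(ℝ, E) ∞ G]
  {E' : Type*} [NormedAddCommGroup E'] [NormedSpace ℝ E']

/-- Differentiate `γ(s) = γ(t) γ(s - t)` at `s = t`: the curve is an integral curve of the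
left-invariant field of `Y`. -/
lemma IsOneParameterSubgroup.mfderiv_apply_one {Y : GroupLieAlgebra 𝓘(ℝ, E) G} {γ : ℝ → G}
    (hγ : IsOneParameterSubgroup Y γ) (t : ℝ) :
    (mfderiv 𝓘(ℝ, ℝ) 𝓘(ℝ, E) γ t : ℝ →L[ℝ] E) 1 = mulInvariantVectorField Y (γ t) := by
  have h0 : γ 0 = 1 := by simpa using hγ.map_add 0 0
  have h1 : γ = (fun g => γ t * g) ∘ γ ∘ (fun s => s - t) := by
    ext s; simp [← hγ.map_add]
  have hd (s : ℝ) : MDifferentiableAt 𝓘(ℝ, ℝ) 𝓘(ℝ, E) γ s :=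
    hγ.contMDiff.mdifferentiableAt (by simp)
  have hs : HasMFDerivAt 𝓘(ℝ, ℝ) 𝓘(ℝ, ℝ) (fun s : ℝ => s - t) t (ContinuousLinearMap.id ℝ ℝ) :=
    ((hasFDerivAt_id t).sub_const t).hasMFDerivAt
  have hm : MDifferentiableAt 𝓘(ℝ, E) 𝓘(ℝ, E) (fun g : G => γ t * g) 1 :=
    (contMDiff_mul_left (n := ∞)).contMDiffAt.mdifferentiableAt (by simp)
  have h2 : HasMFDerivAt 𝓘(ℝ, ℝ) 𝓘(ℝ, E) (γ ∘ fun s : ℝ => s - t) t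
      ((mfderiv 𝓘(ℝ, ℝ) 𝓘(ℝ, E) γ 0 : ℝ →L[ℝ] E).comp (ContinuousLinearMap.id ℝ ℝ)) := by
    have h : ∀ s : ℝ, s = 0 → HasMFDerivAt 𝓘(ℝ, ℝ) 𝓘(ℝ, E) γ s
        (mfderiv 𝓘(ℝ, ℝ) 𝓘(ℝ, E) γ 0 : ℝ →L[ℝ] E) := by
      rintro _ rfl; exact (hd 0).hasMFDerivAt
    exact HasMFDerivAt.comp (f := fun s => s - t) t (h _ (sub_self t)) hs
  have h3 : HasMFDerivAt 𝓘(ℝ, ℝ) 𝓘(ℝ, E) ((fun g => γ t * g) ∘ γ ∘ (fun s => s - t)) t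
      ((mfderiv 𝓘(ℝ, E) 𝓘(ℝ, E) (fun g : G => γ t * g) 1 : E →L[ℝ] E).comp
        ((mfderiv 𝓘(ℝ, ℝ) 𝓘(ℝ, E) γ 0 : ℝ →L[ℝ] E).comp (ContinuousLinearMap.id ℝ ℝ))) := by
    have h : ∀ x : G, x = 1 → HasMFDerivAt 𝓘(ℝ, E) 𝓘(ℝ, E) (fun g : G => γ t * g) x
        (mfderiv 𝓘(ℝ, E) 𝓘(ℝ, E) (fun g : G => γ t * g) 1 : E →L[ℝ] E) := by
      rintro _ rfl; exact hm.hasMFDerivAt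
    exact (h _ (by simp [h0])).comp t h2
  rw [← h1] at h3
  rw [h3.mfderiv]
  exact congrArg (mfderiv 𝓘(ℝ, E) 𝓘(ℝ, E) (fun g : G => γ t * g) 1) hγ.velocity

variable {H : Subgroup G} [ChartedSpace E' (G ⧸ H)] [ContMDiffSMul 𝓘(ℝ, E) 𝓘(ℝ, E') ∞ G (G ⧸ H)]

/-- The projection maps the left-invariant vector field of `W` at `g` to the translate by `g` of
`dπ(W)`. -/
lemma mfderiv_mk_mulInvariantVectorField (hGH : IsQuotientStructure (E := E) (E' := E') H) (g : G)
    (W : GroupLieAlgebra 𝓘(ℝ, E) G) :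
    (mfderiv 𝓘(ℝ, E) 𝓘(ℝ, E') (fun g : G => (g : G ⧸ H)) g : E →L[ℝ] E')
        (mulInvariantVectorField W g) =
      (mfderiv 𝓘(ℝ, E') 𝓘(ℝ, E') (fun z : G ⧸ H => g • z) (basePoint H) : E' →L[ℝ] E')
        (dProj H W) := by
  have hπ : MDifferentiable 𝓘(ℝ, E) 𝓘(ℝ, E') (fun g : G => (g : G ⧸ H)) :=
    hGH.contMDiff.mdifferentiable (by simp)
  have hm : MDifferentiableAt 𝓘(ℝ, E) 𝓘(ℝ, E) (fun x : G => g * x) 1 :=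
    (contMDiff_mul_left (n := ∞)).contMDiffAt.mdifferentiableAt (by simp)
  have hs : ContMDiff 𝓘(ℝ, E') 𝓘(ℝ, E') ∞ (fun z : G ⧸ H => g • z) :=
    (contMDiff_const (c := g) (I' := 𝓘(ℝ, E))).smul (n := ∞) contMDiff_id
  have h1 := mfderiv_comp_apply_of_eq (x := (1 : G)) (f := fun x : G => g * x) (hπ g) hm
    (mul_one g) W
  have h2 := mfderiv_comp_apply (1 : G) (hs.mdifferentiable (by simp) _) (hπ 1) W
  -- The projection after left translation by `g` and the action of `g` after the projection are the
  -- same map definitionally.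
  exact h1.symm.trans h2

variable [IsManifold 𝓘(ℝ, E') ∞ (G ⧸ H)]

/-- With `V = W = Y` this gives the constant speed of `exp(tY)·o`. -/
lemma IsInvariantMetric.inner_mfderiv_mk {a : RiemannianMetricOn E' (G ⧸ H)}
    (ha : IsInvariantMetric a) (hGH : IsQuotientStructure (E := E) (E' := E') H) (g : G)
    (V W : GroupLieAlgebra 𝓘(ℝ, E) G) :
    a.inner (g : G ⧸ H)
        (mfderiv 𝓘(ℝ, E) 𝓘(ℝ, E') (fun g : G => (g : G ⧸ H)) g (mulInvariantVectorField V g))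
        (mfderiv 𝓘(ℝ, E) 𝓘(ℝ, E') (fun g : G => (g : G ⧸ H)) g (mulInvariantVectorField W g)) =
      a.inner (basePoint H) (dProj H V) (dProj H W) := by
  have h : ∀ p : G ⧸ H, p = g • basePoint H → ∀ v w : E',
      v = (mfderiv 𝓘(ℝ, E') 𝓘(ℝ, E') (fun z : G ⧸ H => g • z) (basePoint H) : E' →L[ℝ] E')
        (dProj H V) →
      w = (mfderiv 𝓘(ℝ, E') 𝓘(ℝ, E') (fun z : G ⧸ H => g • z) (basePoint H) : E' →L[ℝ] E')
        (dProj H W) →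
      (a.inner p : E' →L[ℝ] E' →L[ℝ] ℝ) v w = a.inner (basePoint H) (dProj H V) (dProj H W) := by
    rintro p rfl v w rfl rfl
    exact ha g _ _ _
  exact h _ (mk_eq_smul_basePoint g) _ _ (mfderiv_mk_mulInvariantVectorField hGH g V)
    (mfderiv_mk_mulInvariantVectorField hGH g W)

/-- The pullback of `β` to `G` is left-invariant. This serves twice: `β` is constant on the
velocity, and Cartan's formula loses its derivative terms. -/
lemma IsInvariantMetric.inner_field_mfderiv_mk {a : RiemannianMetricOn E' (G ⧸ H)}
    (ha : IsInvariantMetric a) (hGH : IsQuotientStructure (E := E) (E' := E') H)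
    {X : (x : G ⧸ H) → TangentSpace 𝓘(ℝ, E') x} (hX : IsInvariantField X) (g : G)
    (W : GroupLieAlgebra 𝓘(ℝ, E) G) :
    a.inner (g : G ⧸ H) (X g)
        (mfderiv 𝓘(ℝ, E) 𝓘(ℝ, E') (fun g : G => (g : G ⧸ H)) g (mulInvariantVectorField W g)) =
      a.inner (basePoint H) (X (basePoint H)) (dProj H W) := by
  have h : ∀ p : G ⧸ H, p = g • basePoint H → ∀ w : E',
      w = (mfderiv 𝓘(ℝ, E') 𝓘(ℝ, E') (fun z : G ⧸ H => g • z) (basePoint H) : E' →L[ℝ] E')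
        (dProj H W) →
      (a.inner p : E' →L[ℝ] E' →L[ℝ] ℝ) (X p) w =
        a.inner (basePoint H) (X (basePoint H)) (dProj H W) := by
    rintro p rfl w rfl
    rw [← hX g]
    exact ha g _ _ _
  exact h _ (mk_eq_smul_basePoint g) _ (mfderiv_mk_mulInvariantVectorField hGH g W)

/-- The pullback to `G` of the invariant one-form `β = a(X, ·)` is left-invariant, so its exterior
derivative at `(Y, W)` is `-a(X, [Y, W])`, and `dβ` vanishes there when `a(X, [Y, W]) = 0`. -/
lemma IsInvariantMetric.fderiv_chartForm_symm [FiniteDimensional ℝ E] [FiniteDimensional ℝ E']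
    {a : RiemannianMetricOn E' (G ⧸ H)}
    (ha : IsInvariantMetric a) (hGH : IsQuotientStructure (E := E) (E' := E') H)
    {X : (x : G ⧸ H) → TangentSpace 𝓘(ℝ, E') x} (hX : IsInvariantField X)
    (hXs : ContMDiff 𝓘(ℝ, E') (𝓘(ℝ, E').prod 𝓘(ℝ, E')) ∞
      (fun x => (⟨x, X x⟩ : TangentBundle 𝓘(ℝ, E') (G ⧸ H)))) (x₀ : G ⧸ H) (g : G)
    (hg : (g : G ⧸ H) ∈ (extChartAt 𝓘(ℝ, E') x₀).source)
    {Y W : GroupLieAlgebra 𝓘(ℝ, E) G}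
    (hYW : a.inner (basePoint H) (X (basePoint H)) (dProj H ⁅Y, W⁆) = 0)
    {v w : E'}
    (hv : v = (mfderiv 𝓘(ℝ, E') 𝓘(ℝ, E') (extChartAt 𝓘(ℝ, E') x₀) (g : G ⧸ H) : E' →L[ℝ] E')
      (mfderiv 𝓘(ℝ, E) 𝓘(ℝ, E') (fun g : G => (g : G ⧸ H)) g (mulInvariantVectorField Y g)))
    (hw : w = (mfderiv 𝓘(ℝ, E') 𝓘(ℝ, E') (extChartAt 𝓘(ℝ, E') x₀) (g : G ⧸ H) : E' →L[ℝ] E')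
      (mfderiv 𝓘(ℝ, E) 𝓘(ℝ, E') (fun g : G => (g : G ⧸ H)) g (mulInvariantVectorField W g))) :
    fderiv ℝ (chartForm a X x₀) (extChartAt 𝓘(ℝ, E') x₀ (g : G ⧸ H)) v w =
      fderiv ℝ (chartForm a X x₀) (extChartAt 𝓘(ℝ, E') x₀ (g : G ⧸ H)) w v := by
  have hG3 : LieGroup 𝓘(ℝ, E) (minSmoothness ℝ 3) G :=
    LieGroup.of_le (n := ∞) (by simp only [minSmoothness_of_isRCLikeNormedField]; norm_cast)
  have hG2 : IsManifold 𝓘(ℝ, E) 2 G := IsManifold.of_le (n := ∞) (by norm_cast)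
  have hE : CompleteSpace E := FiniteDimensional.complete ℝ E
  -- Everything is transported to `E` by the chart at `g`: the projection becomes `U`, and the
  -- left-invariant fields become the fields `pull Z` below.
  let ψ := (extChartAt 𝓘(ℝ, E) g).symm
  let e := extChartAt 𝓘(ℝ, E) g g
  let p : G → G ⧸ H := fun g => (g : G ⧸ H)
  let U : E → E' := fun x => extChartAt 𝓘(ℝ, E') x₀ (p (ψ x))
  have hψe : ψ e = g := extChartAt_to_inv g
  have hψ : ContMDiffOn 𝓘(ℝ, E) 𝓘(ℝ, E) ∞ ψ (extChartAt 𝓘(ℝ, E) g).target :=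
    contMDiffOn_extChartAt_symm g
  have ho : IsOpen (extChartAt 𝓘(ℝ, E) g).target := isOpen_extChartAt_target g
  have he : e ∈ (extChartAt 𝓘(ℝ, E) g).target := mem_extChartAt_target g
  have hpψ : ContMDiffOn 𝓘(ℝ, E) 𝓘(ℝ, E') ∞ (fun x => p (ψ x)) (extChartAt 𝓘(ℝ, E) g).target :=
    hGH.contMDiff.comp_contMDiffOn hψ
  have hev : ∀ᶠ x in 𝓝 e, x ∈ (extChartAt 𝓘(ℝ, E) g).target ∧
      p (ψ x) ∈ (extChartAt 𝓘(ℝ, E') x₀).source := by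
    refine (ho.eventually_mem he).and ?_
    refine (hpψ.contMDiffAt (ho.mem_nhds he)).continuousAt.eventually_mem ?_
    exact (isOpen_extChartAt_source x₀).mem_nhds (by rw [hψe]; exact hg)
  have hU : ContDiffAt ℝ 2 U e := by
    have h1 : ContMDiffAt 𝓘(ℝ, E') 𝓘(ℝ, E') ∞ (extChartAt 𝓘(ℝ, E') x₀) (p (ψ e)) :=
      contMDiffAt_extChartAt' (by rw [hψe]; simpa using hg)
    have h2 := (h1.comp e (hpψ.contMDiffAt (ho.mem_nhds he))).contDiffAt
    exact h2.of_le (by norm_cast)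
  have hdU : ∀ x ∈ (extChartAt 𝓘(ℝ, E) g).target, p (ψ x) ∈ (extChartAt 𝓘(ℝ, E') x₀).source →
      ∀ u : E, (mfderiv 𝓘(ℝ, E') 𝓘(ℝ, E') (extChartAt 𝓘(ℝ, E') x₀).symm (U x) : E' →L[ℝ] E')
        (fderiv ℝ U x u) =
      (mfderiv 𝓘(ℝ, E) 𝓘(ℝ, E') p (ψ x) : E →L[ℝ] E')
        ((mfderiv 𝓘(ℝ, E) 𝓘(ℝ, E) ψ x : E →L[ℝ] E) u) := by
    intro x hx hx' u
    rw [mfderiv_extChartAt_symm_fderiv (f := fun x => p (ψ x))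
      ((hpψ.contMDiffAt (ho.mem_nhds hx)).mdifferentiableAt (by simp)) hx']
    exact mfderiv_comp_apply x (hGH.contMDiff.mdifferentiableAt (by simp))
      ((hψ.contMDiffAt (ho.mem_nhds hx)).mdifferentiableAt (by simp)) u
  let pull (Z : GroupLieAlgebra 𝓘(ℝ, E) G) : E → E :=
    VectorField.mpullbackWithin 𝓘(ℝ, E) 𝓘(ℝ, E) ψ (mulInvariantVectorField Z)
      (Set.range 𝓘(ℝ, E))
  have hpull : ∀ Z, ∀ x ∈ (extChartAt 𝓘(ℝ, E) g).target,
      (mfderiv 𝓘(ℝ, E) 𝓘(ℝ, E) ψ x : E →L[ℝ] E) (pull Z x) = mulInvariantVectorField Z (ψ x) := by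
    intro Z x hx
    obtain ⟨A, hA⟩ := isInvertible_mfderivWithin_extChartAt_symm (I := 𝓘(ℝ, E)) hx
    simp only [pull, VectorField.mpullbackWithin_apply, ψ]
    rw [← mfderivWithin_univ, ← ModelWithCorners.range_eq_univ (I := 𝓘(ℝ, E)), ← hA,
      ContinuousLinearMap.inverse_equiv]
    exact A.apply_symm_apply _
  have hpulld : ∀ Z, DifferentiableAt ℝ (pull Z) e := by
    intro Z
    have h := VectorField.contMDiffWithinAt_mpullbackWithin_extChartAt_symm (n := 2) (m := 1) (s := Set.univ)
      (x := g)
      ((contMDiffAt_mulInvariantVectorField Z (g := g)).of_le (m := 1) (by simp only [minSmoothness_of_isRCLikeNormedField]; norm_cast)).contMDiffWithinAt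
      uniqueMDiffOn_univ (Set.mem_univ _) (by norm_num)
    have h2 := contMDiffWithinAt_vectorSpace_iff_contDiffWithinAt.1 h
    refine (h2.contDiffAt ?_).differentiableAt one_ne_zero
    rw [Set.preimage_univ, Set.inter_univ]
    exact ho.mem_nhds he
  have hconst : ∀ Z, ∀ᶠ x in 𝓝 e, chartForm a X x₀ (U x) (fderiv ℝ U x (pull Z x)) =
      a.inner (basePoint H) (X (basePoint H)) (dProj H Z) := by
    intro Z
    filter_upwards [hev] with x hx
    rw [← ha.inner_field_mfderiv_mk hGH hX (ψ x) Z, chartForm_extChartAt_apply a X hx.2,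
      hdU x hx.1 hx.2, hpull Z x hx.1]
  -- A preferred chart has identity derivative at its own centre, so no change of coordinates
  -- appears at `e`.
  have hψid : ∀ u : E, (mfderiv 𝓘(ℝ, E) 𝓘(ℝ, E) ψ e : E →L[ℝ] E) u = u := by
    intro u
    have h := mfderiv_extChartAt_symm_mfderiv_extChartAt (mem_extChartAt_source (I := 𝓘(ℝ, E)) g) u
    rwa [mfderiv_extChartAt_self] at h
  have hid : ∀ Z, pull Z e = mulInvariantVectorField Z g := by
    intro Z
    have h : ∀ q : G, q = g → (mulInvariantVectorField Z q : E) = mulInvariantVectorField Z g := by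
      rintro _ rfl; rfl
    exact (hψid _).symm.trans ((hpull Z e he).trans (h _ hψe))
  -- The bracket of left-invariant fields is the left-invariant field of the bracket, and on a
  -- manifold it is computed in the chart centred at `g`.
  have hbr : VectorField.lieBracket ℝ (pull Y) (pull W) e = mulInvariantVectorField ⁅Y, W⁆ g := by
    rw [GroupLieAlgebra.bracket_def, mulInvariantVector_mlieBracket,
      ← VectorField.mlieBracketWithin_univ, VectorField.mlieBracketWithin_apply]
    have h : ∀ A : E →L[ℝ] E, A = ContinuousLinearMap.id ℝ E → ∀ u, A.inverse u = u := by
      rintro _ rfl u; simp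
    refine Eq.trans ?_ (h _ mfderiv_extChartAt_self _).symm
    rw [← VectorField.lieBracketWithin_univ]
    have hs : ψ ⁻¹' Set.univ ∩ Set.range 𝓘(ℝ, E) = Set.univ := by simp
    exact congrArg (fun s => VectorField.lieBracketWithin ℝ (pull Y) (pull W) s e) hs.symm
  have hzero : chartForm a X x₀ (U e) (fderiv ℝ U e
      (VectorField.lieBracket ℝ (pull Y) (pull W) e)) = 0 := by
    rw [hbr, ← hid, (hconst _).self_of_nhds, hYW]
  have hB : DifferentiableAt ℝ (chartForm a X x₀) (U e) :=
    differentiableAt_clm_of_apply fun y => differentiableAt_chartForm_apply a hXs x₀ y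
      ((extChartAt 𝓘(ℝ, E') x₀).map_source hev.self_of_nhds.2)
  have key := fderiv_apply_sub_eq_of_const hB hU (hpulld Y) (hpulld W) (hconst Y) (hconst W)
  have hUe : U e = extChartAt 𝓘(ℝ, E') x₀ (g : G ⧸ H) := by simp only [U, hψe, p]
  have hfd : ∀ Z, fderiv ℝ U e (pull Z e) =
      (mfderiv 𝓘(ℝ, E') 𝓘(ℝ, E') (extChartAt 𝓘(ℝ, E') x₀) (g : G ⧸ H) : E' →L[ℝ] E')
      (mfderiv 𝓘(ℝ, E) 𝓘(ℝ, E') (fun g : G => (g : G ⧸ H)) g (mulInvariantVectorField Z g)) := by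
    intro Z
    have h : ∀ q : G, q = g → (mfderiv 𝓘(ℝ, E') 𝓘(ℝ, E') (extChartAt 𝓘(ℝ, E') x₀) (p q) :
          E' →L[ℝ] E')
        ((mfderiv 𝓘(ℝ, E) 𝓘(ℝ, E') p q : E →L[ℝ] E') (mulInvariantVectorField Z q)) =
        (mfderiv 𝓘(ℝ, E') 𝓘(ℝ, E') (extChartAt 𝓘(ℝ, E') x₀) (p g) : E' →L[ℝ] E')
        ((mfderiv 𝓘(ℝ, E) 𝓘(ℝ, E') p g : E →L[ℝ] E') (mulInvariantVectorField Z g)) := by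
      rintro _ rfl; rfl
    refine Eq.trans ?_ (h _ hψe)
    rw [← hpull Z e he, ← hdU e he hev.self_of_nhds.2]
    exact (mfderiv_extChartAt_mfderiv_extChartAt_symm hev.self_of_nhds.2 _).symm
  rw [hzero, neg_zero, sub_eq_zero, hUe, hfd, hfd, ← hv, ← hw] at key
  exact key

end Homogeneous

/-! ### Nonvanishing of the coefficient and comparison of the equations along `exp(tY)·o`. -/

section GeodesicVector

open Filter Topology

lemma metric_apply_sq_le {E M : Type*} [NormedAddCommGroup E] [NormedSpace ℝ E]
    [TopologicalSpace M] [ChartedSpace E M] [IsManifold 𝓘(ℝ, E) ∞ M]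
    (a : RiemannianMetricOn E M) (x : M) (u v : TangentSpace 𝓘(ℝ, E) x) :
    a.inner x u v ^ 2 ≤ a.inner x u u * a.inner x v v := by
  let B : LinearMap.BilinForm ℝ (TangentSpace 𝓘(ℝ, E) x) :=
    LinearMap.mk₂ ℝ (fun u v => a.inner x u v) (by simp) (by simp) (by simp) (by simp)
  exact B.apply_sq_le_of_symm (fun v => metric_self_nonneg a x v) ⟨fun u v => a.symm x u v⟩ u v

/-- For `r = a(X, v) / α(v)` the number `φ(r) (φ(r) - r φ'(r))` does not vanish. -/
lemma IsAlphaBetaData.differentiableAt_and_ne_zero {E M : Type*} [NormedAddCommGroup E]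
    [NormedSpace ℝ E] [TopologicalSpace M] [ChartedSpace E M] [IsManifold 𝓘(ℝ, E) ∞ M]
    {a : RiemannianMetricOn E M} {X : (x : M) → TangentSpace 𝓘(ℝ, E) x} {φ : ℝ → ℝ} {b₀ : ℝ}
    (h : IsAlphaBetaData a X φ b₀) {x : M} {v : TangentSpace 𝓘(ℝ, E) x} (hv : v ≠ 0) {r : ℝ}
    (hr : r = a.inner x (X x) v / Real.sqrt (a.inner x v v)) :
    DifferentiableAt ℝ φ r ∧ φ r * (φ r - r * deriv φ r) ≠ 0 := by
  have hp := a.pos x v hv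
  have hle : |r| ≤ riemannianNorm a x (X x) := by
    rw [hr, abs_div, abs_of_nonneg (Real.sqrt_nonneg _), div_le_iff₀ (Real.sqrt_pos.2 hp),
      riemannianNorm, ← Real.sqrt_mul (metric_self_nonneg a _ _)]
    exact Real.abs_le_sqrt (metric_apply_sq_le a x _ _)
  have hlt : |r| < b₀ := hle.trans_lt (h.norm_lt x)
  have hmem : r ∈ Set.Ioo (-b₀) b₀ := abs_lt.1 hlt
  refine ⟨(h.contDiffOn.contDiffAt (isOpen_Ioo.mem_nhds hmem)).differentiableAt (by simp), ?_⟩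
  -- The choice `b = |r|` removes the `φ''` term.
  have h1 := h.regular r |r| le_rfl hlt
  rw [sq_abs, sub_self, zero_mul, add_zero] at h1
  exact (mul_pos (h.pos r hmem) h1).ne'

variable {E : Type*} [NormedAddCommGroup E] [NormedSpace ℝ E]
  {G : Type*} [TopologicalSpace G] [ChartedSpace E G] [Group G]
  {E' : Type*} [NormedAddCommGroup E'] [NormedSpace ℝ E']

lemma exists_mulInvariantVectorField_eq [LieGroup 𝓘(ℝ, E) ∞ G] (g : G) (v : TangentSpace 𝓘(ℝ, E) g) :
    ∃ Z : GroupLieAlgebra 𝓘(ℝ, E) G, mulInvariantVectorField Z g = v := by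
  have hm (g x : G) : MDifferentiableAt 𝓘(ℝ, E) 𝓘(ℝ, E) (fun x : G => g * x) x :=
    (contMDiff_mul_left (n := ∞)).contMDiffAt.mdifferentiableAt (by simp)
  refine ⟨(mfderiv 𝓘(ℝ, E) 𝓘(ℝ, E) (fun x : G => g⁻¹ * x) g : E →L[ℝ] E) v, ?_⟩
  have h := mfderiv_comp_apply_of_eq (x := g) (y := 1) (f := fun x : G => g⁻¹ * x)
    (hm g 1) (hm g⁻¹ g) (inv_mul_cancel g) v
  have hid : (fun x : G => g * x) ∘ (fun x : G => g⁻¹ * x) = id := by ext x; simp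
  rw [hid, mfderiv_id] at h
  exact h.symm

variable {H : Subgroup G} [ChartedSpace E' (G ⧸ H)]

lemma IsReductiveDecomposition.proj_mem {m : Submodule ℝ (GroupLieAlgebra 𝓘(ℝ, E) G)}
    (hm : IsReductiveDecomposition (E' := E') H m) (Z : GroupLieAlgebra 𝓘(ℝ, E) G) :
    hm.proj Z ∈ m :=
  Submodule.projection_apply_mem hm.isCompl Z

lemma IsReductiveDecomposition.dProj_proj {m : Submodule ℝ (GroupLieAlgebra 𝓘(ℝ, E) G)}
    (hm : IsReductiveDecomposition (E' := E') H m) (Z : GroupLieAlgebra 𝓘(ℝ, E) G) :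
    dProj (E' := E') H (hm.proj Z) = dProj H Z := by
  have h : Z - hm.proj Z ∈ isotropyAlgebra (E := E) (E' := E') H :=
    Submodule.sub_projection_mem hm.isCompl Z
  have h2 : dProj (E' := E') H (Z - hm.proj Z) = 0 := h
  rw [map_sub, sub_eq_zero] at h2
  exact h2.symm

/-- The kernel of `dπ` is `𝔥`, which meets `𝔪` only in zero. Thus the orbit has nonzero velocity and
`α` is positive on it. -/
lemma IsReductiveDecomposition.dProj_ne_zero {m : Submodule ℝ (GroupLieAlgebra 𝓘(ℝ, E) G)}
    (hm : IsReductiveDecomposition (E' := E') H m) {Z : GroupLieAlgebra 𝓘(ℝ, E) G}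
    (hZ : hm.proj Z ≠ 0) : dProj (E' := E') H Z ≠ 0 := by
  intro h
  refine hZ (Submodule.disjoint_def.1 hm.isCompl.disjoint _ (hm.proj_mem Z) ?_)
  exact (hm.dProj_proj Z).trans h

variable [LieGroup 𝓘(ℝ, E) ∞ G] [ContMDiffSMul 𝓘(ℝ, E) 𝓘(ℝ, E') ∞ G (G ⧸ H)]

/-- Every tangent vector of `G/H` at `gH` is the image of a left-invariant vector field with value
in `𝔪` at the identity. -/
lemma IsReductiveDecomposition.exists_mfderiv_mk_eq
    {m : Submodule ℝ (GroupLieAlgebra 𝓘(ℝ, E) G)}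
    (hm : IsReductiveDecomposition (E' := E') H m)
    (hGH : IsQuotientStructure (E := E) (E' := E') H) (g : G)
    (u : TangentSpace 𝓘(ℝ, E') (g : G ⧸ H)) :
    ∃ W ∈ m, mfderiv 𝓘(ℝ, E) 𝓘(ℝ, E') (fun g : G => (g : G ⧸ H)) g
      (mulInvariantVectorField W g) = u := by
  obtain ⟨v, rfl⟩ := hGH.submersion g u
  obtain ⟨Z, rfl⟩ := exists_mulInvariantVectorField_eq g v
  refine ⟨hm.proj Z, hm.proj_mem Z, ?_⟩
  have h := mfderiv_mk_mulInvariantVectorField hGH g (hm.proj Z)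
  rw [hm.dProj_proj] at h
  exact h.trans (mfderiv_mk_mulInvariantVectorField hGH g Z).symm

/-- Along `t ↦ exp(tY)·o` the Euler-Lagrange equations of an invariant `(α, β)`-metric and of `α`
agree, provided that `a(X, [Y, Z]) = 0` for `Z ∈ 𝔪`. -/
lemma IsOneParameterSubgroup.eulerLagrange_alphaBetaMetric_iff [FiniteDimensional ℝ E]
    [FiniteDimensional ℝ E'] [IsManifold 𝓘(ℝ, E') ∞ (G ⧸ H)]
    (hGH : IsQuotientStructure (E := E) (E' := E') H)
    {m : Submodule ℝ (GroupLieAlgebra 𝓘(ℝ, E) G)}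
    (hm : IsReductiveDecomposition (E' := E') H m)
    {a : RiemannianMetricOn E' (G ⧸ H)} (ha : IsInvariantMetric a)
    {X : (x : G ⧸ H) → TangentSpace 𝓘(ℝ, E') x} (hX : IsInvariantField X)
    {φ : ℝ → ℝ} {b₀ : ℝ} (hφ : IsAlphaBetaData a X φ b₀)
    {Y : GroupLieAlgebra 𝓘(ℝ, E) G} (hY : dProj (E' := E') H Y ≠ 0)
    (hXY : ∀ Z ∈ m, a.inner (basePoint H) (X (basePoint H)) (dProj H ⁅Y, Z⁆) = 0)
    {γ : ℝ → G} (hγ : IsOneParameterSubgroup Y γ) (x₀ : G ⧸ H) (t : ℝ)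
    (ht : (γ t : G ⧸ H) ∈ (extChartAt 𝓘(ℝ, E') x₀).source) :
    let c : ℝ → E' := fun s => extChartAt 𝓘(ℝ, E') x₀ (γ s : G ⧸ H)
    HasDerivAt
        (fun s => fderiv ℝ (fun y => chartEnergy (alphaBetaMetric a X φ) x₀ (c s) y) (deriv c s))
        (fderiv ℝ (fun x => chartEnergy (alphaBetaMetric a X φ) x₀ x (deriv c t)) (c t)) t ↔
      HasDerivAt
        (fun s => fderiv ℝ (fun y => chartEnergy (riemannianNorm a) x₀ (c s) y) (deriv c s))
        (fderiv ℝ (fun x => chartEnergy (riemannianNorm a) x₀ x (deriv c t)) (c t)) t := by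
  intro c
  have hx : ContMDiff 𝓘(ℝ, ℝ) 𝓘(ℝ, E') ∞ (fun s => (γ s : G ⧸ H)) :=
    hGH.contMDiff.comp hγ.contMDiff
  have hvel (s : ℝ) : (mfderiv 𝓘(ℝ, ℝ) 𝓘(ℝ, E') (fun s => (γ s : G ⧸ H)) s : ℝ →L[ℝ] E') 1 =
      (mfderiv 𝓘(ℝ, E) 𝓘(ℝ, E') (fun g : G => (g : G ⧸ H)) (γ s) : E →L[ℝ] E')
        (mulInvariantVectorField Y (γ s)) := by
    rw [← hγ.mfderiv_apply_one s]
    exact mfderiv_comp_apply s (hGH.contMDiff.mdifferentiableAt (by simp))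
      (hγ.contMDiff.mdifferentiableAt (by simp)) (1 : ℝ)
  have hc' (s : ℝ) (hs : (γ s : G ⧸ H) ∈ (extChartAt 𝓘(ℝ, E') x₀).source) :
      (mfderiv 𝓘(ℝ, E') 𝓘(ℝ, E') (extChartAt 𝓘(ℝ, E') x₀).symm (c s) : E' →L[ℝ] E')
        (deriv c s) =
      (mfderiv 𝓘(ℝ, E) 𝓘(ℝ, E') (fun g : G => (g : G ⧸ H)) (γ s) : E →L[ℝ] E')
        (mulInvariantVectorField Y (γ s)) := by
    rw [← hvel]
    exact mfderiv_extChartAt_symm_fderiv (f := fun s => (γ s : G ⧸ H))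
      (hx.mdifferentiableAt (by simp)) hs 1
  have hev : ∀ᶠ s in 𝓝 t, (γ s : G ⧸ H) ∈ (extChartAt 𝓘(ℝ, E') x₀).source :=
    hx.continuous.continuousAt.eventually_mem ((isOpen_extChartAt_source x₀).mem_nhds ht)
  have hct : c t ∈ (extChartAt 𝓘(ℝ, E') x₀).target := (extChartAt 𝓘(ℝ, E') x₀).map_source ht
  set N := a.inner (basePoint H) (dProj H Y) (dProj H Y)
  have hNpos : 0 < N := a.pos _ _ hY
  have h2N : 2 * (N / 2) = N := by ring
  obtain ⟨hφd, hφ0⟩ := hφ.differentiableAt_and_ne_zero hY rfl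
  have hcd : HasDerivAt c (deriv c t) t := by
    have h1 : ContMDiffAt 𝓘(ℝ, E') 𝓘(ℝ, E') ∞ (extChartAt 𝓘(ℝ, E') x₀) (γ t : G ⧸ H) :=
      contMDiffAt_extChartAt' (by simpa using ht)
    exact ((h1.comp t hx.contMDiffAt).contDiffAt.differentiableAt (by simp)).hasDerivAt
  have hB : DifferentiableAt ℝ (chartForm a X x₀) (c t) :=
    differentiableAt_clm_of_apply fun y =>
      differentiableAt_chartForm_apply a hφ.contMDiff_field x₀ y hct
  -- The energy is half the squared speed, so `l = N / 2` and `√(2l) = √N`.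
  refine hasDerivAt_alphaBetaMetric_iff a hφ.contMDiff_field x₀ (l := N / 2)
    (b := a.inner (basePoint H) (X (basePoint H)) (dProj H Y)) (by positivity)
    (by rw [h2N]) hφd hφ0 hct ?_ ?_ ?_
  · filter_upwards [hev] with s hs
    exact (chartEnergy_riemannianNorm_extChartAt a hs (hc' s hs)).trans
      (by rw [ha.inner_mfderiv_mk hGH])
  · filter_upwards [hev] with s hs
    refine (chartForm_extChartAt_apply a X hs _).trans ?_
    exact (congrArg (a.inner (γ s : G ⧸ H) (X (γ s : G ⧸ H)) : E' →L[ℝ] ℝ) (hc' s hs)).trans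
      (ha.inner_field_mfderiv_mk hGH hX _ _)
  -- The equation for `β` says that its derivative in the chart is symmetric on the pairs `(c', w)`,
  -- that is `dβ(c', w) = 0` for every `w`.
  · refine (hB.hasFDerivAt.comp_hasDerivAt t hcd).congr_deriv ?_
    ext w
    have hw : fderiv ℝ (fun z => chartForm a X x₀ z (deriv c t)) (c t) w =
        fderiv ℝ (chartForm a X x₀) (c t) w (deriv c t) := by
      rw [(hB.hasFDerivAt.clm_apply (hasFDerivAt_const (deriv c t) (c t))).fderiv]
      simp
    rw [hw]
    -- The bracket hypothesis concerns `𝔪` only, so `w` is represented by an element of `𝔪`.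
    obtain ⟨W, hW, hWw⟩ := hm.exists_mfderiv_mk_eq hGH (γ t)
      ((mfderiv 𝓘(ℝ, E') 𝓘(ℝ, E') (extChartAt 𝓘(ℝ, E') x₀).symm (c t) : E' →L[ℝ] E') w)
    refine ha.fderiv_chartForm_symm hGH hX hφ.contMDiff_field x₀ (γ t) ht (hXY W hW) ?_ ?_
    · rw [← hc' t ht]
      exact (mfderiv_extChartAt_mfderiv_extChartAt_symm ht _).symm
    · rw [hWw]
      exact (mfderiv_extChartAt_mfderiv_extChartAt_symm ht _).symm

end GeodesicVector

end

theorem mainTheorem2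
    {E : Type*} [NormedAddCommGroup E] [NormedSpace ℝ E] [FiniteDimensional ℝ E]
    {G : Type*} [TopologicalSpace G] [ChartedSpace E G] [Group G] [LieGroup 𝓘(ℝ, E) ∞ G]
    (H : Subgroup G) (hH : IsClosed (H : Set G))
    {E' : Type*} [NormedAddCommGroup E'] [NormedSpace ℝ E'] [FiniteDimensional ℝ E']
    [ChartedSpace E' (G ⧸ H)] [IsManifold 𝓘(ℝ, E') ∞ (G ⧸ H)]
    [ContMDiffSMul 𝓘(ℝ, E) 𝓘(ℝ, E') ∞ G (G ⧸ H)]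
    (hGH : IsQuotientStructure (E := E) (E' := E') H)
    (m : Submodule ℝ (GroupLieAlgebra 𝓘(ℝ, E) G))
    (hm : IsReductiveDecomposition (E' := E') H m)
    (a : RiemannianMetricOn E' (G ⧸ H)) (ha : IsInvariantMetric a)
    (X : (x : G ⧸ H) → TangentSpace 𝓘(ℝ, E') x) (hX : IsInvariantField X)
    (φ : ℝ → ℝ) (b₀ : ℝ) (hφ : IsAlphaBetaData a X φ b₀)
    (Y : GroupLieAlgebra 𝓘(ℝ, E) G) (hYm : hm.proj Y ≠ 0)
    (hr : deriv (deriv φ)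
      (innerAtBase a (X (basePoint H)) (hm.proj Y) /
        Real.sqrt (innerAtBase a (dProj H (hm.proj Y)) (hm.proj Y))) ≤ 0)
    (hXY : ∀ Z ∈ m, innerAtBase a (X (basePoint H)) (hm.proj ⁅Y, Z⁆) = 0) :
    IsGeodesicVector H (alphaBetaMetric a X φ) Y ↔
      IsGeodesicVector H (riemannianNorm a) Y := by
  have hY0 := hm.dProj_ne_zero hYm
  have key : ∀ γ : ℝ → G, IsOneParameterSubgroup Y γ →
      (IsGeodesic (alphaBetaMetric a X φ) (fun t => γ t • basePoint H) ↔
        IsGeodesic (riemannianNorm a) (fun t => γ t • basePoint H)) := by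
    intro γ hγ
    simp only [← mk_eq_smul_basePoint]
    -- Passing to the `𝔪`-component does not change the image under `dπ`.
    have hXY' : ∀ Z ∈ m, a.inner (basePoint H) (X (basePoint H)) (dProj H ⁅Y, Z⁆) = 0 := by
      intro Z hZ
      rw [← hm.dProj_proj]
      exact hXY Z hZ
    have core := hγ.eulerLagrange_alphaBetaMetric_iff hGH hm ha hX hφ hY0 hXY'
    exact ⟨fun h => ⟨h.contMDiff, fun x₀ t ht => (core x₀ t ht).1 (h.euler_lagrange x₀ t ht)⟩,
      fun h => ⟨h.contMDiff, fun x₀ t ht => (core x₀ t ht).2 (h.euler_lagrange x₀ t ht)⟩⟩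
  -- The equivalence holds for each one-parameter subgroup separately, so the same `γ` serves for
  -- both metrics.
  exact and_congr_right fun _ => exists_congr fun γ => and_congr_right fun hγ => key γ hγ
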